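/- For $n\ge 1$ let $L_n$ be the linear hexagonal chain with $n$ hexagons: its vertices are $p_0,\dots,p_n$, $q_0,\dots,q_n$, $u_0,\dots,u_{n-1}$, $v_0,\dots,v_{n-1}$, and its edges are $p_iq_i$ for $0\le i\le n$ together with $p_iu_i,\ u_ip_{i+1},\ q_iv_i,\ v_iq_{i+1}$ for $0\le i\le n-1$ (so the $i$-th hexagon is the 6-cycle $p_{i-1},u_{i-1},p_i,q_i,v_{i-1},q_{i-1}$, $1\le i\le n$). For vertices $a,b$ of $L_n$ let $r(a,b)$ be the effective resistance (resistance distance) between $a$ and $b$ when every edge of $L_n$ is a unit resistor, that is, the potential difference between $a$ and $b$ when a unit current enters at $a$ and leaves at $b$. Then for all vertices $a,b$ of $L_n$, $$r(p_0,q_n)\ \ge\ r(a,b),$$ and for all vertices $a\ne b$ of $L_n$, $$r(a,b)\ \ge\ r\bigl(p_{\lfloor n/2\rfloor},q_{\lfloor n/2\rfloor}\bigr).$$ -/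

import Mathlib

/-- A potential `φ : V → ℝ` that drives a unit current from `a` to `b` through the electrical
network obtained from the finite graph `G` by replacing every edge with a unit resistor.
By Ohm's law the current from `x` to a neighbour `y` is `φ x - φ y`, so `(L φ) x` (with `L` the
Laplacian of `G`) is the net current leaving `x`; by Kirchhoff's current law it has to be
`1` at `a`, `-1` at `b`, and `0` at the other vertices (and `0` everywhere if `a = b`). -/
def IsUnitCurrentPotential {V : Type*} [Fintype V] [DecidableEq V] (G : SimpleGraph V)
    [DecidableRel G.Adj] (a b : V) (φ : V → ℝ) : Prop :=
  Matrix.mulVec (G.lapMatrix ℝ) φ = Pi.single a 1 - Pi.single b 1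

open Classical in
/-- The effective resistance (resistance distance) between `a` and `b` in the network of unit
resistors on the finite graph `G`: the potential difference between `a` and `b` when a unit
current flows from `a` to `b`. It does not depend on the potential
(`effectiveResistance_eq`), and a potential exists whenever `G` is connected
(`exists_isUnitCurrentPotential`). -/
noncomputable def effectiveResistance {V : Type*} [Fintype V] (G : SimpleGraph V) (a b : V) : ℝ :=
  if h : ∃ φ : V → ℝ, IsUnitCurrentPotential G a b φ then h.choose a - h.choose b else 0

/-- The potential difference between `a` and `b` is the same for all unit current potentials. -/
theorem effectiveResistance_eq {V : Type*} [Fintype V] [DecidableEq V] (G : SimpleGraph V)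
    [DecidableRel G.Adj] (a b : V) (φ : V → ℝ) (hφ : IsUnitCurrentPotential G a b φ) :
    effectiveResistance G a b = φ a - φ b := by
  classical
  have key : ∀ ψ : V → ℝ, IsUnitCurrentPotential G a b ψ → ψ a - ψ b = φ a - φ b := by
    intro ψ hψ
    have h1 : dotProduct ψ (Matrix.mulVec (G.lapMatrix ℝ) φ) = ψ a - ψ b := by
      rw [hφ]; simp [dotProduct_sub]
    have h2 : dotProduct φ (Matrix.mulVec (G.lapMatrix ℝ) ψ) = φ a - φ b := by
      rw [hψ]; simp [dotProduct_sub]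
    rw [← h1, ← h2, Matrix.dotProduct_mulVec, ← Matrix.mulVec_transpose,
      (G.isSymm_lapMatrix (R := ℝ)).eq, dotProduct_comm]
  have hex : ∃ ψ : V → ℝ, IsUnitCurrentPotential G a b ψ := ⟨φ, hφ⟩
  have h' : ∃ ψ : V → ℝ, @IsUnitCurrentPotential V _ (fun x y => Classical.propDecidable (x = y)) G
      (fun x y => Classical.propDecidable (G.Adj x y)) a b ψ := by
    convert hex
  rw [effectiveResistance, dif_pos h']
  apply key
  convert h'.choose_spec

/-- In a finite connected graph a unit current potential exists for every pair of vertices. -/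
theorem exists_isUnitCurrentPotential {V : Type*} [Fintype V] [DecidableEq V] (G : SimpleGraph V)
    [DecidableRel G.Adj] (hG : G.Connected) (a b : V) :
    ∃ φ : V → ℝ, IsUnitCurrentPotential G a b φ := by
  have hN : (Fintype.card V : ℝ) ≠ 0 := by
    have := Nonempty.intro a
    exact_mod_cast Fintype.card_ne_zero
  have hsum : ∀ φ : V → ℝ, ∑ x, Matrix.mulVec (G.lapMatrix ℝ) φ x = 0 := by
    intro φ
    have h : dotProduct (fun _ => (1 : ℝ)) (Matrix.mulVec (G.lapMatrix ℝ) φ) = 0 := by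
      rw [Matrix.dotProduct_mulVec, ← Matrix.mulVec_transpose,
        (G.isSymm_lapMatrix (R := ℝ)).eq, G.lapMatrix_mulVec_const_eq_zero, zero_dotProduct]
    simpa [dotProduct] using h
  let T : (V → ℝ) →ₗ[ℝ] (V → ℝ) :=
    Matrix.mulVecLin (G.lapMatrix ℝ) + Matrix.mulVecLin (Matrix.of fun _ _ => (1 : ℝ))
  have hT : ∀ φ x, T φ x = Matrix.mulVec (G.lapMatrix ℝ) φ x + ∑ y, φ y := by
    intro φ x
    simp [T, Matrix.mulVec, dotProduct]
  have hs : ∀ φ : V → ℝ, ∑ x, T φ x = 0 → ∑ y, φ y = 0 := by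
    intro φ h
    simp only [hT, Finset.sum_add_distrib, hsum, Finset.sum_const, Finset.card_univ,
      nsmul_eq_mul, zero_add] at h
    exact (mul_eq_zero.1 h).resolve_left hN
  have hinj : Function.Injective T := by
    rw [injective_iff_map_eq_zero]
    intro φ h0
    have h1 : ∑ y, φ y = 0 := hs φ (by simp [h0])
    have h2 : Matrix.mulVec (G.lapMatrix ℝ) φ = 0 := by
      funext x
      have := hT φ x
      rw [h1, h0, add_zero] at this
      exact this.symm
    rw [G.lapMatrix_mulVec_eq_zero_iff_forall_reachable] at h2
    funext x
    have h3 : ∀ y, φ y = φ x := fun y => h2 y x (hG.preconnected y x)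
    simp only [h3, Finset.sum_const, Finset.card_univ, nsmul_eq_mul] at h1
    exact (mul_eq_zero.1 h1).resolve_left hN
  obtain ⟨φ, hφ⟩ := (LinearMap.injective_iff_surjective.1 hinj) (Pi.single a 1 - Pi.single b 1)
  have h1 : ∑ y, φ y = 0 := hs φ (by rw [hφ]; simp)
  refine ⟨φ, ?_⟩
  funext x
  have := hT φ x
  rw [h1, add_zero, hφ] at this
  exact this.symm

/-- The vertices `p 0, …, p n`, `q 0, …, q n`, `u 0, …, u (n - 1)`, `v 0, …, v (n - 1)` of the
linear hexagonal chain with `n` hexagons. -/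
inductive HexChainVertex (n : ℕ) : Type
  | p (i : Fin (n + 1))
  | q (i : Fin (n + 1))
  | u (i : Fin n)
  | v (i : Fin n)
  deriving DecidableEq, Fintype

/-- The `5 n + 1` edges of the linear hexagonal chain, each listed in one direction. The hexagon
number `i` (for `i < n`) is the 6-cycle `p i, u i, p (i + 1), q (i + 1), v i, q i`, and
consecutive hexagons share an edge `p i, q i`. -/
inductive HexChainEdge (n : ℕ) : HexChainVertex n → HexChainVertex n → Prop
  | pu (i : Fin n) : HexChainEdge n (.p i.castSucc) (.u i)
  | up (i : Fin n) : HexChainEdge n (.u i) (.p i.succ)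
  | qv (i : Fin n) : HexChainEdge n (.q i.castSucc) (.v i)
  | vq (i : Fin n) : HexChainEdge n (.v i) (.q i.succ)
  | pq (i : Fin (n + 1)) : HexChainEdge n (.p i) (.q i)

/-- The linear hexagonal chain with `n` hexagons. -/
def hexChain (n : ℕ) : SimpleGraph (HexChainVertex n) :=
  SimpleGraph.fromRel (HexChainEdge n)

/-- The linear hexagonal chain is connected. -/
theorem hexChain_connected (n : ℕ) : (hexChain n).Connected := by
  have adj : ∀ x y, HexChainEdge n x y → (hexChain n).Reachable x y := by
    intro x y h
    apply SimpleGraph.Adj.reachable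
    rw [hexChain, SimpleGraph.fromRel_adj]
    refine ⟨?_, Or.inl h⟩
    cases h <;> simp
  have hp : ∀ i : Fin (n + 1), (hexChain n).Reachable (.p 0) (.p i) := by
    intro i
    induction i using Fin.induction with
    | zero => rfl
    | succ i ih => exact (ih.trans (adj _ _ (.pu i))).trans (adj _ _ (.up i))
  have hall : ∀ x, (hexChain n).Reachable (.p 0) x := by
    intro x
    cases x with
    | p i => exact hp i
    | q i => exact (hp i).trans (adj _ _ (.pq i))
    | u i => exact (hp _).trans (adj _ _ (.pu i))
    | v i => exact ((hp _).trans (adj _ _ (.pq _))).trans (adj _ _ (.qv i))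
  have : Nonempty (HexChainVertex n) := ⟨.p 0⟩
  exact ⟨fun x y => (hall x).symm.trans (hall y)⟩

/-!
Exchanging the two rows (`p ↔ q`, `u ↔ v`) is a symmetry of the chain, so the Laplacian splits
into two operators on the path with vertices `0, …, 2 n`, the position of `p i`, `q i` being `2 i`
and that of `u i`, `v i` being `2 i + 1`. On symmetric functions it is the path Laplacian, whose
unit source at `s` has the potential `-|x - s| / 2` up to terms that do not depend on `s`. On
antisymmetric functions it is the path Laplacian plus `2` at every even position (the current
through the rungs); this operator is invertible, and its inverse is
`G(s, t) = W s * W (2 n - t) / Δ` for `s ≤ t`, where `W = antiSol` solves the homogeneous equation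
from the left end and `Δ` is the Wronskian. Hence for vertices at positions `s`, `t`
  `r = |s - t| / 2 + (G(s, s) + G(t, t)) / 2 ∓ G(s, t)`,
with the minus sign for vertices in the same row (`sameResistance`) and the plus sign for vertices
in different rows (`crossResistance`); see `effectiveResistance_hexChain`.

Maximum: since `G > 0` it suffices to bound `crossResistance`. It grows when two distinct positions
are moved apart by one step (`crossResistance_le_succ`), so it is largest at `(0, 2 n)`; the
diagonal at an odd position is reduced to distinct positions by the identity
`crossResistance_self_of_odd`.

Minimum: the rung at position `2 i` has resistance `2 G(2 i, 2 i)`, which is smallest in the middle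
because `k ↦ W (2 k)` is log-convex (`antiSol_even_logConvex`). Two vertices at adjacent positions
have at least the resistance of the rung next to them (`two_mul_green_le_sameResistance_succ`), and
two vertices at distance at least `2` along the path have resistance at least `1`, which no end
rung exceeds. The pairs `u i`, `v i` are again covered by `crossResistance_self_of_odd`.
-/

/-! ### Positions and rows of the vertices -/

namespace HexChainVertex

/-- The position of a vertex along its row: `p i` and `q i` have position `2 i`, `u i` and `v i`
have position `2 i + 1`. -/
def pos {n : ℕ} : HexChainVertex n → ℕ
  | p i => 2 * i
  | q i => 2 * i
  | u i => 2 * i + 1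
  | v i => 2 * i + 1

/-- The row of a vertex, encoded as a sign: `1` for the vertices `p`, `u` and `-1` for `q`, `v`. -/
def side {n : ℕ} : HexChainVertex n → ℝ
  | p _ => 1
  | q _ => -1
  | u _ => 1
  | v _ => -1

theorem pos_le {n : ℕ} (x : HexChainVertex n) : x.pos ≤ 2 * n := by
  cases x <;> simp only [pos] <;> omega

theorem side_mul_self {n : ℕ} (x : HexChainVertex n) : x.side * x.side = 1 := by
  cases x <;> simp [side]

theorem side_eq_or {n : ℕ} (x : HexChainVertex n) : x.side = 1 ∨ x.side = -1 := by
  cases x <;> simp [side]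

theorem eq_of_pos_of_side {n : ℕ} {x y : HexChainVertex n} (h : x.pos = y.pos)
    (h' : x.side = y.side) : x = y := by
  cases x <;> cases y <;> simp only [pos, side] at h h' <;>
    first
    | (exfalso; norm_num at h'; done)
    | (exfalso; omega)
    | (congr 1; ext; omega)

/-- Each position `0, …, 2 n` occurs exactly once in each row. -/
theorem sum_pos_side {n : ℕ} (F : ℕ → ℝ → ℝ) :
    ∑ x : HexChainVertex n, F x.pos x.side = ∑ k ∈ Finset.range (2 * n + 1), (F k 1 + F k (-1)) := by
  let e : (Fin (n + 1) ⊕ Fin (n + 1)) ⊕ (Fin n ⊕ Fin n) ≃ HexChainVertex n :=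
    { toFun := Sum.elim (Sum.elim .p .q) (Sum.elim .u .v)
      invFun := fun
        | .p i => .inl (.inl i)
        | .q i => .inl (.inr i)
        | .u i => .inr (.inl i)
        | .v i => .inr (.inr i)
      left_inv := by rintro ((i | i) | (i | i)) <;> rfl
      right_inv := by rintro (i | i | i | i) <;> rfl }
  have hsplit : ∀ (g : ℕ → ℝ) (m : ℕ), ∑ k ∈ Finset.range (2 * m + 1), g k =
      ∑ i ∈ Finset.range (m + 1), g (2 * i) + ∑ i ∈ Finset.range m, g (2 * i + 1) := by
    intro g m
    induction m with
    | zero => simp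
    | succ m ih =>
      rw [show 2 * (m + 1) + 1 = 2 * m + 1 + 1 + 1 by ring, Finset.sum_range_succ,
        Finset.sum_range_succ, ih, Finset.sum_range_succ _ (m + 1),
        Finset.sum_range_succ (fun i => g (2 * i + 1)) m,
        show 2 * m + 1 + 1 = 2 * (m + 1) by ring]
      ring
  rw [← e.sum_comp, Finset.sum_add_distrib, hsplit, hsplit]
  simp only [Fintype.sum_sum_type, e, Equiv.coe_fn_mk, Sum.elim_inl, Sum.elim_inr, pos, side,
    ← Fin.sum_univ_eq_sum_range]
  ring

end HexChainVertex

open HexChainVertex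

theorem hexChainEdge_iff {n : ℕ} (x y : HexChainVertex n) :
    HexChainEdge n x y ↔ (y.pos = x.pos + 1 ∧ x.side = y.side) ∨
      (x.pos = y.pos ∧ x.side = 1 ∧ y.side = -1 ∧ Even x.pos) := by
  constructor
  · rintro (i | i | i | i | i) <;> simp [pos, side] <;> omega
  · intro h
    cases x <;> cases y <;> simp only [pos, side] at h <;> norm_num at h <;>
    first
    | (exfalso; first | omega | grind)
    | (rename_i i j
       obtain rfl : i = j.castSucc := by ext; simp; omega
       constructor)
    | (rename_i i j
       obtain rfl : j = i.succ := by ext; simp; omega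
       constructor)
    | (rename_i i j
       obtain rfl : i = j := by ext; omega
       constructor)

theorem hexChain_adj_iff {n : ℕ} (x y : HexChainVertex n) :
    (hexChain n).Adj x y ↔ ((y.pos = x.pos + 1 ∨ x.pos = y.pos + 1) ∧ x.side = y.side) ∨
      (x.pos = y.pos ∧ x.side = - y.side ∧ Even x.pos) := by
  rw [hexChain, SimpleGraph.fromRel_adj, hexChainEdge_iff, hexChainEdge_iff]
  constructor
  · grind
  · intro h
    refine ⟨?_, ?_⟩
    · rintro rfl
      rcases x.side_eq_or with h1 | h1 <;> rw [h1] at h <;> norm_num at h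
    · rcases x.side_eq_or with h1 | h1 <;> rcases y.side_eq_or with h2 | h2 <;>
        rw [h1, h2] at h ⊢ <;> norm_num at h ⊢ <;> grind

/-- The Laplacian of the path with vertices `0, 1, …, N`, applied to `f` at the vertex `k ≤ N`. -/
noncomputable def pathLaplacian (N : ℕ) (f : ℕ → ℝ) (k : ℕ) : ℝ :=
  (if k < N then f k - f (k + 1) else 0) + (if 0 < k then f k - f (k - 1) else 0)

/-! ### The Laplacian of the chain -/

theorem lapMatrix_mulVec_eq_sum {V : Type*} [Fintype V] [DecidableEq V] (G : SimpleGraph V)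
    [DecidableRel G.Adj] (φ : V → ℝ) (x : V) :
    Matrix.mulVec (G.lapMatrix ℝ) φ x = ∑ y, if G.Adj x y then φ x - φ y else 0 := by
  rw [SimpleGraph.lapMatrix_mulVec_apply, ← Finset.sum_filter, Finset.sum_sub_distrib,
    Finset.sum_const, nsmul_eq_mul, ← SimpleGraph.card_neighborFinset_eq_degree,
    SimpleGraph.neighborFinset_eq_filter]

/-- The Laplacian of the chain acts separately on the symmetric part `A` and the antisymmetric part
`B` of a function; a rung carries the current `2 * B`. -/
theorem hexChain_lapMatrix_mulVec {n : ℕ} [DecidableRel (hexChain n).Adj] (A B : ℕ → ℝ)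
    (x : HexChainVertex n) :
    Matrix.mulVec ((hexChain n).lapMatrix ℝ) (fun y => A y.pos + y.side * B y.pos) x =
      pathLaplacian (2 * n) A x.pos +
        x.side * (pathLaplacian (2 * n) B x.pos + if Even x.pos then 2 * B x.pos else 0) := by
  classical
  rw [lapMatrix_mulVec_eq_sum]
  simp only [hexChain_adj_iff]
  rw [sum_pos_side (fun k e => if (((k = x.pos + 1 ∨ x.pos = k + 1) ∧ x.side = e) ∨
      (x.pos = k ∧ x.side = - e ∧ Even x.pos)) then
        (A x.pos + x.side * B x.pos) - (A k + e * B k) else 0)]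
  have hm := x.pos_le
  generalize x.pos = m at hm ⊢
  have key : ∀ k : ℕ,
      ((if (((k = m + 1 ∨ m = k + 1) ∧ x.side = 1) ∨ (m = k ∧ x.side = - 1 ∧ Even m)) then
        (A m + x.side * B m) - (A k + 1 * B k) else 0) +
      (if (((k = m + 1 ∨ m = k + 1) ∧ x.side = -1) ∨ (m = k ∧ x.side = - -1 ∧ Even m)) then
        (A m + x.side * B m) - (A k + -1 * B k) else 0)) =
      (if k = m + 1 then (A m - A (m + 1)) + x.side * (B m - B (m + 1)) else 0) +
      (if k + 1 = m then (A m - A (m - 1)) + x.side * (B m - B (m - 1)) else 0) +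
      (if k = m then x.side * (if Even m then 2 * B m else 0) else 0) := by
    intro k
    have h1 : ¬ ((1 : ℝ) = -1) := by norm_num
    have h2 : ¬ ((-1 : ℝ) = 1) := by norm_num
    rcases eq_or_ne k (m + 1) with rfl | hk1
    · rcases x.side_eq_or with h | h <;> rw [h] <;> simp [h1, h2, add_assoc] <;> ring
    rcases eq_or_ne m (k + 1) with rfl | hk2
    · rcases x.side_eq_or with h | h <;> rw [h] <;> simp [h1, h2, add_assoc] <;> ring
    rcases eq_or_ne k m with rfl | hk3
    · rcases x.side_eq_or with h | h <;> rw [h] <;> by_cases he : Even k <;>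
        simp [h1, h2, he] <;> ring
    · simp [hk1, hk2, hk3, hk2.symm, hk3.symm]
  rw [Finset.sum_congr rfl fun k _ => key k, Finset.sum_add_distrib, Finset.sum_add_distrib,
    Finset.sum_ite_eq', Finset.sum_ite_eq', if_pos (by simp; omega : m ∈ _)]
  have hpred : ∀ c : ℝ, ∑ k ∈ Finset.range (2 * n + 1), (if k + 1 = m then c else 0) =
      if 0 < m then c else 0 := by
    intro c
    cases m with
    | zero => simp
    | succ m =>
      simp only [Nat.add_right_cancel_iff, Finset.sum_ite_eq', Finset.mem_range]
      rw [if_pos (by omega), if_pos (by omega)]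
  rw [hpred]
  simp only [pathLaplacian, Finset.mem_range, Nat.add_lt_add_iff_right]
  split_ifs <;> ring

/-! ### The Green function of the antisymmetric part -/

/-- The solution `1, 3, 5, 17, 29, …` of the homogeneous antisymmetric equation with the boundary
condition at the left end: the path Laplacian plus `2` at even positions annihilates it (see
`antiSol_homogeneous`). The value at `k + 2` is determined by the equation at `k + 1`. -/
noncomputable def antiSol : ℕ → ℝ
  | 0 => 1
  | 1 => 3
  | k + 2 => (if Even k then 2 else 4) * antiSol (k + 1) - antiSol k

theorem antiSol_zero : antiSol 0 = 1 := rfl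
theorem antiSol_one : antiSol 1 = 3 := rfl

theorem antiSol_add_two_of_even {k : ℕ} (hk : Even k) :
    antiSol (k + 2) = 2 * antiSol (k + 1) - antiSol k := by
  rw [antiSol, if_pos hk]

theorem antiSol_add_two_of_odd {k : ℕ} (hk : Odd k) :
    antiSol (k + 2) = 4 * antiSol (k + 1) - antiSol k := by
  rw [antiSol, if_neg (Nat.not_even_iff_odd.2 hk)]

theorem antiSol_even_pos_and_three_mul_le (i : ℕ) :
    0 < antiSol (2 * i) ∧ 3 * antiSol (2 * i) ≤ antiSol (2 * i + 1) := by
  induction i with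
  | zero => norm_num [antiSol_zero, antiSol_one]
  | succ i ih =>
    have h1 := antiSol_add_two_of_even (even_two_mul i)
    have h2 := antiSol_add_two_of_odd (odd_two_mul_add_one i)
    rw [show 2 * (i + 1) = 2 * i + 2 by ring]
    constructor <;> linarith

theorem three_mul_antiSol_le {k : ℕ} (hk : Even k) : 3 * antiSol k ≤ antiSol (k + 1) := by
  obtain ⟨i, rfl⟩ := hk.two_dvd
  exact (antiSol_even_pos_and_three_mul_le i).2

theorem antiSol_pos (k : ℕ) : 0 < antiSol k := by
  obtain ⟨i, rfl | rfl⟩ := Nat.even_or_odd' k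
  · exact (antiSol_even_pos_and_three_mul_le i).1
  · linarith [(antiSol_even_pos_and_three_mul_le i).1, (antiSol_even_pos_and_three_mul_le i).2]

theorem antiSol_monotone : Monotone antiSol := by
  refine monotone_nat_of_le_succ fun k => ?_
  obtain ⟨i, rfl | rfl⟩ := Nat.even_or_odd' k
  · linarith [(antiSol_even_pos_and_three_mul_le i).1, (antiSol_even_pos_and_three_mul_le i).2]
  · linarith [(antiSol_even_pos_and_three_mul_le i).1, (antiSol_even_pos_and_three_mul_le i).2,
      antiSol_add_two_of_even (even_two_mul i)]

theorem five_mul_antiSol_le {k : ℕ} (hk : Even k) : 5 * antiSol k ≤ antiSol (k + 2) := by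
  linarith [three_mul_antiSol_le hk, antiSol_add_two_of_even hk]

/-- The Wronskian `W (s + 1) * W (2 n - s) - W s * W (2 n - s - 1)` of `W = antiSol` and its mirror
image, which does not depend on `s` (`wronskian_eq`); the definition is the value at `s = 0`. -/
noncomputable def wronskian (n : ℕ) : ℝ := 3 * antiSol (2 * n) - antiSol (2 * n - 1)

theorem wronskian_eq {n s t : ℕ} (h : s + t + 1 = 2 * n) :
    antiSol (s + 1) * antiSol (t + 1) - antiSol s * antiSol t = wronskian n := by
  induction s generalizing t with
  | zero =>
    rw [wronskian, ← h]
    simp [antiSol_zero, antiSol_one]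
  | succ s ih =>
    rw [← ih (t := t + 1) (by omega)]
    rcases Nat.even_or_odd s with hs | hs
    · have ht : Even t := by grind
      rw [add_assoc s, add_assoc t, antiSol_add_two_of_even hs, antiSol_add_two_of_even ht]
      ring
    · have ht : Odd t := by grind
      rw [add_assoc s, add_assoc t, antiSol_add_two_of_odd hs, antiSol_add_two_of_odd ht]
      ring

theorem wronskian_pos (n : ℕ) : 0 < wronskian n := by
  have h := antiSol_monotone (Nat.sub_le (2 * n) 1)
  have h' := antiSol_pos (2 * n)
  rw [wronskian]
  linarith

/-- The Green function of the path Laplacian on `0, …, 2 n` plus `2` at even positions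
(`pathLaplacian_green`). -/
noncomputable def green (n s k : ℕ) : ℝ :=
  antiSol (min s k) * antiSol (2 * n - max s k) / wronskian n

theorem green_comm (n s k : ℕ) : green n s k = green n k s := by
  rw [green, green, min_comm, max_comm]

theorem green_of_le {n s k : ℕ} (h : s ≤ k) :
    green n s k = antiSol s * antiSol (2 * n - k) / wronskian n := by
  rw [green, min_eq_left h, max_eq_right h]

theorem green_of_ge {n s k : ℕ} (h : k ≤ s) :
    green n s k = antiSol k * antiSol (2 * n - s) / wronskian n := by
  rw [green_comm, green_of_le h]

theorem antiSol_homogeneous {k : ℕ} :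
    (antiSol k - antiSol (k + 1)) + (if 0 < k then antiSol k - antiSol (k - 1) else 0) +
      (if Even k then 2 * antiSol k else 0) = 0 := by
  rcases k with _ | k
  · norm_num [antiSol_zero, antiSol_one]
  · rcases Nat.even_or_odd k with hk | hk
    · have := antiSol_add_two_of_even hk
      have h' : ¬ Even (k + 1) := by grind
      simp [h']; linarith
    · have := antiSol_add_two_of_odd hk
      have h' : Even (k + 1) := by grind
      simp [h']; linarith

theorem pathLaplacian_green {n s k : ℕ} (hn : 1 ≤ n) (hs : s ≤ 2 * n) (hk : k ≤ 2 * n) :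
    pathLaplacian (2 * n) (green n s) k + (if Even k then 2 * green n s k else 0) =
      if k = s then 1 else 0 := by
  have hΔ := (wronskian_pos n).ne'
  obtain ⟨k', hk'⟩ := Nat.exists_eq_add_of_le hk
  have hpar : Even k' ↔ Even k := by grind
  -- `e1` is the homogeneous equation from the left end, `e2` its mirror image.
  have e1 := antiSol_homogeneous (k := k)
  have e2 := antiSol_homogeneous (k := k')
  simp only [hpar] at e2
  have hE : ∀ c : ℝ, (if Even k then 2 * c else 0) = (if Even k then 2 else 0) * c := by
    intro c; split_ifs <;> ring
  rw [hE] at e1 e2 ⊢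
  generalize (if Even k then (2 : ℝ) else 0) = c at *
  unfold pathLaplacian
  rcases lt_trichotomy k s with h | rfl | h
  · rw [if_pos (by omega : k < 2 * n), if_neg h.ne, green_of_ge h.le,
      green_of_ge (by omega : k + 1 ≤ s), green_of_ge (by omega : k - 1 ≤ s)]
    split_ifs at e1 ⊢ <;> linear_combination (antiSol (2 * n - s) / wronskian n) * e1
  · rw [if_pos rfl, green_of_le le_rfl, green_of_le (by omega : k ≤ k + 1),
      green_of_ge (by omega : k - 1 ≤ k)]
    -- At the right end the equation at `k' = 0` only says that the coefficient `c` is `2`.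
    rcases k' with _ | t
    · have hc : c = 2 := by
        simp only [antiSol_zero, zero_add, antiSol_one] at e2
        norm_num at e2
        linarith
      obtain rfl : k = 2 * n := by omega
      rw [if_neg (lt_irrefl _), if_pos (by omega), Nat.sub_self, antiSol_zero, hc]
      field_simp
      rw [wronskian]
      ring
    · have hw := wronskian_eq (n := n) (s := k) (t := t) (by omega)
      rw [if_pos (by omega), show 2 * n - k = t + 1 by omega,
        show 2 * n - (k + 1) = t by omega]
      split_ifs at e1 ⊢ <;> field_simp <;> linear_combination hw + antiSol (t + 1) * e1
  · have hk2 : k < 2 * n ↔ 0 < k' := by omega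
    rw [if_pos (by omega : 0 < k), if_neg h.ne', green_of_le h.le,
      green_of_le (by omega : s ≤ k + 1), green_of_le (by omega : s ≤ k - 1),
      show 2 * n - k = k' by omega, show 2 * n - (k + 1) = k' - 1 by omega,
      show 2 * n - (k - 1) = k' + 1 by omega]
    simp only [hk2]
    split_ifs at e2 ⊢ <;> linear_combination (antiSol s / wronskian n) * e2

/-! ### The effective resistance in closed form -/

theorem pathLaplacian_abs_sub {N s k : ℕ} (hN : 0 < N) (hs : s ≤ N) (hk : k ≤ N) :
    pathLaplacian N (fun j => -|(j : ℝ) - s| / 4) k =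
      (if k = s then 1 / 2 else 0) - (if k = 0 then 1 / 4 else 0) - (if k = N then 1 / 4 else 0) := by
  have hle : ∀ j : ℕ, j ≤ s → |(j : ℝ) - s| = s - j := fun j hj => by
    rw [abs_sub_comm, abs_of_nonneg (sub_nonneg.2 (by exact_mod_cast hj))]
  have hge : ∀ j : ℕ, s ≤ j → |(j : ℝ) - s| = j - s := fun j hj => by
    rw [abs_of_nonneg (sub_nonneg.2 (by exact_mod_cast hj))]
  simp only [pathLaplacian]
  rcases k with _ | k
  · rcases Nat.eq_zero_or_pos s with rfl | h
    · rw [hge _ le_rfl, hge _ (by omega)]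
      simp [hN, hN.ne]; norm_num
    · rw [hle _ h.le, hle _ (by omega)]
      simp [hN, hN.ne, h.ne]; ring
  · rw [Nat.add_sub_cancel]
    rcases lt_trichotomy (k + 1) s with h | rfl | h
    · rw [hle _ h.le, hle _ (by omega), hle _ (by omega)]
      have h1 : k + 1 < N := by omega
      simp [h1, h1.ne, h.ne]; ring
    · rw [hge _ le_rfl, hge _ (by omega), hle _ (by omega)]
      rcases hk.eq_or_lt with rfl | h1
      · simp; ring
      · simp [h1, h1.ne]; ring
    · rw [hge _ h.le, hge _ (by omega), hge _ (by omega)]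
      rcases hk.eq_or_lt with rfl | h1
      · simp [h.ne']; ring
      · simp [h1, h1.ne, h.ne']; ring

/-- The potential of a unit source at `a`, with the current leaving in equal parts through the four
corners `p 0`, `q 0`, `p n`, `q n` (`lapMatrix_mulVec_unitPotential`). The sink does not depend on
`a`, so a difference of two of these is a unit current potential. -/
noncomputable def unitPotential {n : ℕ} (a x : HexChainVertex n) : ℝ :=
  -|(x.pos : ℝ) - a.pos| / 4 + x.side * (a.side / 2 * green n a.pos x.pos)

theorem pathLaplacian_const_mul (N : ℕ) (c : ℝ) (f : ℕ → ℝ) (k : ℕ) :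
    pathLaplacian N (fun j => c * f j) k = c * pathLaplacian N f k := by
  unfold pathLaplacian; split_ifs <;> ring

theorem lapMatrix_mulVec_unitPotential {n : ℕ} [DecidableRel (hexChain n).Adj] (hn : 1 ≤ n)
    (a x : HexChainVertex n) :
    Matrix.mulVec ((hexChain n).lapMatrix ℝ) (unitPotential a) x =
      (Pi.single a 1 : HexChainVertex n → ℝ) x - (if x.pos = 0 then 1 / 4 else 0)
        - (if x.pos = 2 * n then 1 / 4 else 0) := by
  have h := hexChain_lapMatrix_mulVec (n := n) (fun j => -|(j : ℝ) - a.pos| / 4)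
    (fun j => a.side / 2 * green n a.pos j) x
  have hE : (if Even x.pos then 2 * (a.side / 2 * green n a.pos x.pos) else 0) =
      a.side / 2 * (if Even x.pos then 2 * green n a.pos x.pos else 0) := by
    split_ifs <;> ring
  rw [pathLaplacian_abs_sub (by omega) a.pos_le x.pos_le, pathLaplacian_const_mul, hE, ← mul_add,
    pathLaplacian_green hn a.pos_le x.pos_le] at h
  have hs : (Pi.single a 1 : HexChainVertex n → ℝ) x =
      (if x.pos = a.pos then 1 / 2 else 0) +
        x.side * (a.side / 2 * (if x.pos = a.pos then 1 else 0)) := by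
    rcases eq_or_ne x a with rfl | hxa
    · have := x.side_mul_self
      simp only [Pi.single_eq_same, if_true]; linarith
    · rw [Pi.single_eq_of_ne hxa]
      split_ifs with hp
      · have : x.side ≠ a.side := fun h' => hxa (eq_of_pos_of_side hp h')
        rcases x.side_eq_or with h1 | h1 <;> rcases a.side_eq_or with h2 | h2 <;>
          simp [h1, h2] at this ⊢ <;> norm_num
      · ring
  rw [hs]
  refine Eq.trans h ?_
  ring

theorem effectiveResistance_hexChain {n : ℕ} (hn : 1 ≤ n) (a b : HexChainVertex n) :
    effectiveResistance (hexChain n) a b = |(a.pos : ℝ) - b.pos| / 2 +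
      (green n a.pos a.pos + green n b.pos b.pos) / 2 -
        a.side * b.side * green n a.pos b.pos := by
  classical
  have h : IsUnitCurrentPotential (hexChain n) a b (unitPotential a - unitPotential b) := by
    rw [IsUnitCurrentPotential, Matrix.mulVec_sub]
    funext x
    rw [Pi.sub_apply, lapMatrix_mulVec_unitPotential hn, lapMatrix_mulVec_unitPotential hn,
      Pi.sub_apply]
    ring
  rw [effectiveResistance_eq _ _ _ _ h]
  simp only [Pi.sub_apply, unitPotential, sub_self, abs_zero]
  rw [abs_sub_comm (b.pos : ℝ), green_comm n b.pos a.pos]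
  linear_combination (green n a.pos a.pos / 2) * a.side_mul_self +
    (green n b.pos b.pos / 2) * b.side_mul_self

/-- The resistance between vertices at positions `s`, `t` in different rows. -/
noncomputable def crossResistance (n s t : ℕ) : ℝ :=
  |(s : ℝ) - t| / 2 + (green n s s + green n t t) / 2 + green n s t

/-- The resistance between vertices at positions `s`, `t` in the same row. -/
noncomputable def sameResistance (n s t : ℕ) : ℝ :=
  |(s : ℝ) - t| / 2 + (green n s s + green n t t) / 2 - green n s t

theorem green_pos (n s t : ℕ) : 0 < green n s t :=
  div_pos (mul_pos (antiSol_pos _) (antiSol_pos _)) (wronskian_pos n)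

theorem green_reflect {n s t : ℕ} (hs : s ≤ 2 * n) (ht : t ≤ 2 * n) :
    green n (2 * n - s) (2 * n - t) = green n s t := by
  rcases le_total s t with h | h
  · rw [green_of_ge (by omega), green_of_le h, show 2 * n - (2 * n - s) = s by omega, mul_comm]
  · rw [green_of_le (by omega), green_of_ge h, show 2 * n - (2 * n - t) = t by omega, mul_comm]

theorem crossResistance_comm (n s t : ℕ) : crossResistance n s t = crossResistance n t s := by
  rw [crossResistance, crossResistance, abs_sub_comm, green_comm n s t]; ring

theorem sameResistance_comm (n s t : ℕ) : sameResistance n s t = sameResistance n t s := by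
  rw [sameResistance, sameResistance, abs_sub_comm, green_comm n s t]; ring

theorem crossResistance_reflect {n s t : ℕ} (hs : s ≤ 2 * n) (ht : t ≤ 2 * n) :
    crossResistance n (2 * n - s) (2 * n - t) = crossResistance n s t := by
  rw [crossResistance, crossResistance, green_reflect hs hs, green_reflect hs ht,
    green_reflect ht ht, Nat.cast_sub hs, Nat.cast_sub ht, abs_sub_comm]
  congr 3; ring_nf

theorem sameResistance_reflect {n s t : ℕ} (hs : s ≤ 2 * n) (ht : t ≤ 2 * n) :
    sameResistance n (2 * n - s) (2 * n - t) = sameResistance n s t := by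
  rw [sameResistance, sameResistance, green_reflect hs hs, green_reflect hs ht,
    green_reflect ht ht, Nat.cast_sub hs, Nat.cast_sub ht, abs_sub_comm]
  congr 3; ring_nf

theorem effectiveResistance_of_side_eq {n : ℕ} (hn : 1 ≤ n) {a b : HexChainVertex n}
    (h : a.side = b.side) :
    effectiveResistance (hexChain n) a b = sameResistance n a.pos b.pos := by
  rw [effectiveResistance_hexChain hn, ← h, a.side_mul_self, one_mul, sameResistance]

theorem effectiveResistance_of_side_ne {n : ℕ} (hn : 1 ≤ n) {a b : HexChainVertex n}
    (h : a.side ≠ b.side) :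
    effectiveResistance (hexChain n) a b = crossResistance n a.pos b.pos := by
  have : a.side * b.side = -1 := by
    rcases a.side_eq_or with h1 | h1 <;> rcases b.side_eq_or with h2 | h2 <;>
      simp [h1, h2] at h ⊢
  rw [effectiveResistance_hexChain hn, this, crossResistance]
  ring

theorem sameResistance_le_crossResistance (n s t : ℕ) :
    sameResistance n s t ≤ crossResistance n s t := by
  have := green_pos n s t
  rw [sameResistance, crossResistance]; linarith

/-! ### The largest resistance -/

/-- Moving the right vertex of a pair in different rows one step to the right increases the
resistance. This fails for `s = t` odd. -/
theorem crossResistance_le_succ {n s t : ℕ} (hst : s ≤ t) (ht : t < 2 * n)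
    (h : Odd t → s < t) : crossResistance n s t ≤ crossResistance n s (t + 1) := by
  obtain ⟨t', ht'⟩ : ∃ t', t + t' + 1 = 2 * n := ⟨2 * n - (t + 1), by omega⟩
  have hΔ := wronskian_pos n
  have hw := wronskian_eq ht'
  rw [crossResistance, crossResistance, green_of_le le_rfl, green_of_le le_rfl, green_of_le hst,
    green_of_le le_rfl, green_of_le (by omega : s ≤ t + 1),
    abs_sub_comm, abs_of_nonneg (sub_nonneg.2 (by exact_mod_cast hst)), abs_sub_comm,
    abs_of_nonneg (sub_nonneg.2 (by exact_mod_cast (by omega : s ≤ t + 1))),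
    show 2 * n - t = t' + 1 by omega, show 2 * n - (t + 1) = t' by omega]
  have hm := antiSol_monotone (Nat.le_succ t')
  have hm2 := antiSol_monotone (Nat.le_succ t)
  have key : 0 ≤ antiSol (t + 1) * antiSol t' + wronskian n - antiSol t * antiSol (t' + 1)
      - 2 * antiSol s * (antiSol (t' + 1) - antiSol t') := by
    have p1 := antiSol_pos t'
    have p2 := antiSol_pos (t' + 1)
    have p3 := antiSol_pos t
    have p4 := antiSol_pos (t + 1)
    rw [← hw]
    -- The right side decreases in `W s`: bound `W s` by `W t` for `t` even, and by `W (t - 1)` for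
    -- `t` odd, where `s < t`.
    rcases Nat.even_or_odd t with he | ho
    · have h3 := three_mul_antiSol_le he
      have hz := mul_le_mul_of_nonneg_right (antiSol_monotone hst) (sub_nonneg.2 hm)
      nlinarith [mul_nonneg (sub_nonneg.2 h3) p2.le, mul_pos p3 p1, mul_pos p4 p1]
    · obtain ⟨r, rfl⟩ : ∃ r, t = r + 1 := ⟨t - 1, by have := h ho; omega⟩
      have hr : Even r := by grind
      have h3 := three_mul_antiSol_le hr
      have h5 := five_mul_antiSol_le hr
      have h2 := antiSol_add_two_of_even hr
      have hz := mul_le_mul_of_nonneg_right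
        (antiSol_monotone (by have := h ho; omega : s ≤ r)) (sub_nonneg.2 hm)
      have h6 : 0 ≤ antiSol (r + 1 + 1) - antiSol (r + 1) - 2 * antiSol r := by
        rw [show r + 1 + 1 = r + 2 from rfl]; linarith
      have h7 := antiSol_pos r
      nlinarith [mul_nonneg h6 p2.le, mul_nonneg h6 p1.le, mul_pos h7 p1]
  have := div_nonneg key hΔ.le
  have hid : (antiSol (t + 1) * antiSol t' + wronskian n - antiSol t * antiSol (t' + 1)
      - 2 * antiSol s * (antiSol (t' + 1) - antiSol t')) / wronskian n =
      antiSol (t + 1) * antiSol t' / wronskian n + 1 - antiSol t * antiSol (t' + 1) / wronskian n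
      - 2 * (antiSol s * antiSol (t' + 1) / wronskian n - antiSol s * antiSol t' / wronskian n) := by
    field_simp
  rw [hid] at this
  push_cast
  linarith

/-- `u i` and `v i` are at the same resistance as `p i` and `q (i + 1)`. -/
theorem crossResistance_self_of_odd {n s : ℕ} (hs : Even s) (h : s + 2 ≤ 2 * n) :
    crossResistance n (s + 1) (s + 1) = crossResistance n s (s + 2) := by
  obtain ⟨t, ht⟩ : ∃ t, s + t + 2 = 2 * n := ⟨2 * n - (s + 2), by omega⟩
  have hΔ := (wronskian_pos n).ne'
  have ht' : Even t := by grind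
  have hw := wronskian_eq (n := n) (s := s) (t := t + 1) (by omega)
  have e1 := antiSol_add_two_of_even hs
  have e2 := antiSol_add_two_of_even ht'
  rw [crossResistance, crossResistance, green_of_le le_rfl, green_of_le le_rfl,
    green_of_le le_rfl, green_of_le (by omega : s ≤ s + 2), abs_sub_comm (s : ℝ),
    show 2 * n - (s + 1) = t + 1 by omega, show 2 * n - s = t + 2 by omega,
    show 2 * n - (s + 2) = t by omega]
  push_cast
  rw [sub_self, abs_zero, add_sub_cancel_left, abs_of_pos two_pos]
  field_simp
  rw [← hw, add_assoc t, e1, e2]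
  ring

theorem crossResistance_mono_right {n s t t' : ℕ} (hst : s < t) (htt : t ≤ t')
    (ht : t' ≤ 2 * n) : crossResistance n s t ≤ crossResistance n s t' := by
  induction t', htt using Nat.le_induction with
  | base => rfl
  | succ k hk ih =>
    exact (ih (by omega)).trans
      (crossResistance_le_succ (by omega) (by omega) fun _ => by omega)

theorem crossResistance_le_of_lt {n s t : ℕ} (hst : s < t) (ht : t ≤ 2 * n) :
    crossResistance n s t ≤ crossResistance n 0 (2 * n) := by
  refine (crossResistance_mono_right hst ht le_rfl).trans ?_
  rw [← crossResistance_reflect (by omega) le_rfl, Nat.sub_self, crossResistance_comm]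
  exact crossResistance_mono_right (by omega) (Nat.sub_le _ _) le_rfl

theorem crossResistance_le {n s t : ℕ} (hn : 1 ≤ n) (hs : s ≤ 2 * n) (ht : t ≤ 2 * n) :
    crossResistance n s t ≤ crossResistance n 0 (2 * n) := by
  have hdiag : ∀ r < 2 * n, crossResistance n r r ≤ crossResistance n 0 (2 * n) := by
    intro r hr
    rcases Nat.even_or_odd r with he | ho
    · exact (crossResistance_le_succ le_rfl hr fun ho => by grind).trans
        (crossResistance_le_of_lt (by omega) (by omega))
    · obtain ⟨i, rfl⟩ := ho
      rw [crossResistance_self_of_odd (even_two_mul i) (by omega)]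
      exact crossResistance_le_of_lt (by omega) (by omega)
  rcases lt_trichotomy s t with h | rfl | h
  · exact crossResistance_le_of_lt h ht
  · rcases hs.eq_or_lt with rfl | h
    · rw [← crossResistance_reflect le_rfl le_rfl, Nat.sub_self]
      exact hdiag 0 (by omega)
    · exact hdiag s h
  · rw [crossResistance_comm]
    exact crossResistance_le_of_lt h hs

/-! ### The smallest resistance -/

/-- The sequence `w k = W (2 k)` satisfies `w (k + 2) = 6 w (k + 1) - w k`, so the difference of the
two sides does not change with `i`. -/
theorem antiSol_even_logConvex (i k : ℕ) :
    antiSol (2 * (i + 1)) * antiSol (2 * (i + k)) ≤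
      antiSol (2 * i) * antiSol (2 * (i + k + 1)) := by
  have rec6 : ∀ j, antiSol (2 * (j + 2)) = 6 * antiSol (2 * (j + 1)) - antiSol (2 * j) := by
    intro j
    have h1 := antiSol_add_two_of_even (even_two_mul j)
    have h2 := antiSol_add_two_of_odd (odd_two_mul_add_one j)
    have h3 := antiSol_add_two_of_even (even_two_mul (j + 1))
    rw [show 2 * (j + 2) = 2 * (j + 1) + 2 by ring, h3]
    simp only [mul_add, mul_one, add_assoc, Nat.reduceAdd] at h1 h2 ⊢
    linarith
  induction i with
  | zero =>
    have h1 : antiSol (2 * (0 + 1)) = 5 := by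
      have := antiSol_add_two_of_even (Even.zero : Even 0)
      norm_num [antiSol_one, antiSol_zero] at this ⊢
      exact this
    have := five_mul_antiSol_le (even_two_mul k)
    rw [h1, mul_zero, antiSol_zero, one_mul, zero_add]
    exact this
  | succ i ih =>
    rw [show i + 1 + 1 = i + 2 by ring, rec6, show i + 1 + k + 1 = (i + k) + 2 by ring, rec6,
      show i + 1 + k = i + k + 1 by ring]
    linarith

theorem green_middle_le {n i : ℕ} (hi : i ≤ n) :
    green n (2 * (n / 2)) (2 * (n / 2)) ≤ green n (2 * i) (2 * i) := by
  have main : ∀ j, j ≤ n / 2 →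
      green n (2 * (n / 2)) (2 * (n / 2)) ≤ green n (2 * j) (2 * j) := by
    intro j hj
    induction hj using Nat.decreasingInduction with
    | self => rfl
    | of_succ j hj ih =>
      refine ih.trans ?_
      rw [green_of_le le_rfl, green_of_le le_rfl, ← Nat.mul_sub, ← Nat.mul_sub]
      have := antiSol_even_logConvex j (n - (2 * j + 1))
      rw [show j + (n - (2 * j + 1)) = n - (j + 1) by omega,
        show n - (j + 1) + 1 = n - j by omega] at this
      exact div_le_div_of_nonneg_right this (wronskian_pos n).le
  rcases le_total i (n / 2) with h | h
  · exact main i h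
  · rcases h.eq_or_lt with rfl | h
    · rfl
    · rw [← green_reflect (by omega : 2 * i ≤ 2 * n) (by omega), ← Nat.mul_sub]
      exact main _ (by omega)

/-- The resistance of an end rung is at most `1`. -/
theorem two_mul_green_zero_le (n : ℕ) : 2 * green n 0 0 ≤ 1 := by
  rw [green_of_le le_rfl, antiSol_zero, ← mul_div_assoc, div_le_one (wronskian_pos n), wronskian]
  have := antiSol_monotone (Nat.sub_le (2 * n) 1)
  rw [Nat.sub_zero]
  linarith

theorem two_mul_green_le_sameResistance_succ {n s : ℕ} (hs : Even s) (h : s < 2 * n) :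
    2 * green n s s ≤ sameResistance n s (s + 1) := by
  obtain ⟨t, ht⟩ : ∃ t, s + t + 1 = 2 * n := ⟨2 * n - (s + 1), by omega⟩
  have hΔ := wronskian_pos n
  have hw := wronskian_eq ht
  have h3 := three_mul_antiSol_le hs
  rw [sameResistance, green_of_le le_rfl, green_of_le le_rfl, green_of_le (by omega : s ≤ s + 1),
    abs_sub_comm, show 2 * n - s = t + 1 by omega, show 2 * n - (s + 1) = t by omega]
  push_cast
  rw [add_sub_cancel_left, abs_one]
  field_simp
  rw [← hw]
  nlinarith [mul_nonneg (sub_nonneg.2 h3) (antiSol_pos t).le,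
    mul_nonneg (sub_nonneg.2 h3) (antiSol_pos (t + 1)).le]

/-- The antisymmetric part contributes a nonnegative amount, as `W` is monotone. -/
theorem half_sub_le_sameResistance {n s t : ℕ} (hst : s ≤ t) :
    ((t : ℝ) - s) / 2 ≤ sameResistance n s t := by
  have hΔ := wronskian_pos n
  rw [sameResistance, green_of_le le_rfl, green_of_le le_rfl, green_of_le hst,
    abs_sub_comm, abs_of_nonneg (sub_nonneg.2 (by exact_mod_cast hst))]
  have h1 := antiSol_monotone hst
  have h2 := antiSol_monotone (Nat.sub_le_sub_left hst (2 * n))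
  have key : 0 ≤ (antiSol s * (antiSol (2 * n - s) - antiSol (2 * n - t)) +
      (antiSol t - antiSol s) * antiSol (2 * n - t)) / wronskian n :=
    div_nonneg (add_nonneg (mul_nonneg (antiSol_pos s).le (sub_nonneg.2 h2))
      (mul_nonneg (sub_nonneg.2 h1) (antiSol_pos _).le)) hΔ.le
  have hid : (antiSol s * (antiSol (2 * n - s) - antiSol (2 * n - t)) +
      (antiSol t - antiSol s) * antiSol (2 * n - t)) / wronskian n =
      antiSol s * antiSol (2 * n - s) / wronskian n + antiSol t * antiSol (2 * n - t) / wronskian n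
      - 2 * (antiSol s * antiSol (2 * n - t) / wronskian n) := by ring
  linarith

theorem two_mul_green_middle_le_sameResistance {n s t : ℕ} (hst : s < t) (ht : t ≤ 2 * n) :
    2 * green n (2 * (n / 2)) (2 * (n / 2)) ≤ sameResistance n s t := by
  rcases (Nat.succ_le_of_lt hst).eq_or_lt with rfl | h
  · rcases Nat.even_or_odd s with he | ho
    · obtain ⟨i, rfl⟩ := he.two_dvd
      have := green_middle_le (n := n) (i := i) (by omega)
      have := two_mul_green_le_sameResistance_succ he (n := n) (by omega)
      rw [Nat.succ_eq_add_one]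
      linarith
    · rw [← sameResistance_reflect (by omega) ht, sameResistance_comm,
        show 2 * n - s = (2 * n - s.succ) + 1 by omega]
      have he : Even (2 * n - s.succ) := by grind
      obtain ⟨i, hi⟩ := he.two_dvd
      have h1 := green_middle_le (n := n) (i := i) (by omega)
      have h2 := two_mul_green_le_sameResistance_succ he (n := n) (by omega)
      rw [← hi] at h1
      linarith
  · have h1 := green_middle_le (Nat.zero_le n)
    have h2 := two_mul_green_zero_le n
    have h3 := half_sub_le_sameResistance (n := n) hst.le
    have h4 : ((s + 2 : ℕ) : ℝ) ≤ t := by exact_mod_cast h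
    push_cast at h4
    rw [mul_zero] at h1
    linarith

theorem crossResistance_self (n s : ℕ) : crossResistance n s s = 2 * green n s s := by
  rw [crossResistance, sub_self, abs_zero]; ring

theorem two_mul_green_middle_le_crossResistance {n s : ℕ} (hs : s ≤ 2 * n) :
    2 * green n (2 * (n / 2)) (2 * (n / 2)) ≤ crossResistance n s s := by
  rcases Nat.even_or_odd' s with ⟨i, rfl | rfl⟩
  · rw [crossResistance_self]
    linarith [green_middle_le (n := n) (i := i) (by omega)]
  · rw [crossResistance_self_of_odd (even_two_mul i) (by omega)]
    exact (two_mul_green_middle_le_sameResistance (by omega) (by omega)).trans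
      (sameResistance_le_crossResistance _ _ _)

theorem theorem3p5 (n : ℕ) (hn : 1 ≤ n) (a b : HexChainVertex n) :
    effectiveResistance (hexChain n) a b ≤
        effectiveResistance (hexChain n) (.p 0) (.q (Fin.last n)) ∧
      (a ≠ b →
        effectiveResistance (hexChain n) (.p ⟨n / 2, Nat.lt_succ_of_le (Nat.div_le_self n 2)⟩)
            (.q ⟨n / 2, Nat.lt_succ_of_le (Nat.div_le_self n 2)⟩) ≤
          effectiveResistance (hexChain n) a b) := by
  have hpq : ∀ i j : Fin (n + 1), effectiveResistance (hexChain n) (.p i) (.q j) =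
      crossResistance n (2 * i) (2 * j) := fun i j =>
    effectiveResistance_of_side_ne hn (by norm_num [side])
  rw [hpq, hpq]
  have hle : sameResistance n a.pos b.pos ≤ effectiveResistance (hexChain n) a b ∧
      effectiveResistance (hexChain n) a b ≤ crossResistance n a.pos b.pos := by
    have := sameResistance_le_crossResistance n a.pos b.pos
    by_cases h : a.side = b.side
    · rw [effectiveResistance_of_side_eq hn h]; exact ⟨le_rfl, this⟩
    · rw [effectiveResistance_of_side_ne hn h]; exact ⟨this, le_rfl⟩
  refine ⟨hle.2.trans (crossResistance_le hn a.pos_le b.pos_le), fun hab => ?_⟩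
  rw [crossResistance_self]
  rcases lt_trichotomy a.pos b.pos with h | h | h
  · exact (two_mul_green_middle_le_sameResistance h b.pos_le).trans hle.1
  · rw [effectiveResistance_of_side_ne hn fun h' => hab (eq_of_pos_of_side h h'), ← h]
    exact two_mul_green_middle_le_crossResistance a.pos_le
  · refine (two_mul_green_middle_le_sameResistance h a.pos_le).trans ?_
    rw [sameResistance_comm]
    exact hle.1
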